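/- **Setting.** Let $n\ge 2$. A geometric braid on $n$ strands consists of $n$ continuous paths $t\mapsto(y_i(t),z_i(t))\in\mathbb R^2$, $t\in[0,1]$, which are pairwise disjoint at every time and lead from the $n$ standard points, lying in a row on the $y$-axis and numbered $1,\dots,n$ from top to bottom, to the same set of points. A braid is a homotopy class of such motions, i.e. an element of the fundamental group of the space of $n$-element subsets of the plane, based at the set of standard points; the product $ab$ means $b$ followed by $a$. A geometric braid is drawn by projecting to the $(t,y)$-plane, the $y$-axis pointing upwards, strands with larger $z$ passing over; a crossing is positive if the overstrand is the one that descends as $t$ increases. A braid diagram (with multi-crossings) is such a drawing with finitely many crossing points, where a crossing point is a point at which two or more strands meet, and where any two strands meeting at a crossing point pass through each other there (equivalently, each strand bisects every crossing it passes through). A star diagram is a braid diagram that is connected (as a subset of the plane) and has exactly one crossing point. A braid admits a star diagram if it is represented by a geometric braid whose drawing is a star diagram. For $\pi\in S_n$ let $\mathrm{br}(\pi)$ be the simple braid of $\pi$: the positive braid in which any two strands cross at most once and which takes position $i$ to position $\pi(i)$ for every $i$. Let $\Delta_n$ be the positive half-twist, i.e. the rigid rotation of the row of $n$ points by a half turn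 about its midpoint, with the upper strands passing in front. **Theorem.** Let $n\ge 2$. A braid $b$ on $n$ strands admits a star diagram if and only if \[ b=\Delta_n^{-1}\,\mathrm{br}(\pi^{-1})\,\mathrm{br}(\pi)\] for some permutation $\pi\in S_n$. -/

import Mathlib

open Topology

noncomputable section

namespace Braid

/-! ### The braid group

Geometric picture: a braid is drawn from left to right, `t ∈ [0, 1]` being the horizontal
coordinate. At time `t` each strand is at a point `(y, z) ∈ ℝ × ℝ`, where `y` is the height in the
drawing (upwards) and `z` is the depth coordinate, pointing towards the viewer. Thus `(t, y, z)` is a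
right-handed coordinate system, and of two strands that cross in the drawing, the one with the
greater `z` is the overstrand. -/

/-- Height of the `i`-th position, the positions being numbered from top to bottom. -/
def level {n : ℕ} (i : Fin n) : ℝ := -(i : ℝ)

theorem level_injective {n : ℕ} : Function.Injective (level : Fin n → ℝ) := by
  intro i j h
  have h' : (i : ℝ) = (j : ℝ) := neg_injective h
  exact Fin.ext (by exact_mod_cast h')

/-- Ordered configurations of `n` distinct points of the plane. -/
abbrev OrdConf (n : ℕ) : Type := {p : Fin n → ℝ × ℝ // Function.Injective p}

/-- Two ordered configurations are identified if they differ by a relabelling. -/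
instance confSetoid (n : ℕ) : Setoid (OrdConf n) where
  r p q := ∃ ρ : Equiv.Perm (Fin n), ∀ i, q.1 i = p.1 (ρ i)
  iseqv :=
    { refl := fun _ => ⟨1, fun _ => rfl⟩
      symm := by
        rintro p q ⟨ρ, h⟩
        exact ⟨ρ⁻¹, fun i => by rw [h]; simp⟩
      trans := by
        rintro p q r ⟨ρ, h⟩ ⟨τ, k⟩
        exact ⟨ρ * τ, fun i => by rw [k, h]; rfl⟩ }

/-- The space of `n`-element subsets of the plane, with the quotient topology. -/
abbrev Conf (n : ℕ) : Type := Quotient (confSetoid n)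

/-- The points `(level i, 0)`, where all braids begin and end. -/
def baseOrd (n : ℕ) : OrdConf n :=
  ⟨fun i => (level i, 0), fun _ _ h => level_injective (congrArg Prod.fst h)⟩

def base (n : ℕ) : Conf n := ⟦baseOrd n⟧

/-- The braid group on `n` strands: the fundamental group of the space of `n`-element subsets of the
plane. In Mathlib's fundamental group, the product `a * b` is `b` followed by `a`. -/
abbrev BraidGroup (n : ℕ) : Type := FundamentalGroup (Conf n) (base n)

/-- A geometric braid: `n` strands that are disjoint at each time and run from the `n` standard
points to the `n` standard points. Strands are labelled by their initial positions. -/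
structure GeometricBraid (n : ℕ) where
  strand : Fin n → C(unitInterval, ℝ × ℝ)
  disjoint : ∀ t, Function.Injective fun i => strand i t
  start : ∀ i, strand i 0 = (level i, 0)
  finish : ∃ ρ : Equiv.Perm (Fin n), ∀ i, strand i 1 = (level (ρ i), 0)

namespace GeometricBraid

variable {n : ℕ} (g : GeometricBraid n)

/-- The loop of `n`-element subsets traced out by a geometric braid. -/
def toLoop : Path (base n) (base n) where
  toFun t := ⟦⟨fun i => g.strand i t, g.disjoint t⟩⟧
  continuous_toFun := by
    refine continuous_quotient_mk'.comp (Continuous.subtype_mk ?_ _)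
    exact continuous_pi fun i => (g.strand i).continuous
  source' := by
    refine congrArg _ (Subtype.ext (funext fun i => g.start i))
  target' := by
    obtain ⟨ρ, h⟩ := g.finish
    refine Quotient.sound ⟨ρ⁻¹, fun i => ?_⟩
    simp [baseOrd, h]

/-- The braid represented by a geometric braid. -/
def toBraid : BraidGroup n :=
  FundamentalGroup.fromPath (Path.Homotopic.Quotient.mk g.toLoop)

/-! ### Braid diagrams with multi-crossings -/

/-- The strand `i` in the drawing: its height `y` as a function of `t`. -/
def height (i : Fin n) (t : unitInterval) : ℝ := (g.strand i t).1

/-- The drawing of a geometric braid: the union of its projected strands. -/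
def drawing : Set (unitInterval × ℝ) := ⋃ i, Set.range fun t => (t, g.height i t)

/-- The crossings: the points of the drawing where at least two strands meet. -/
def crossings : Set (unitInterval × ℝ) :=
  {c | ∃ i j, i ≠ j ∧ g.height i c.1 = c.2 ∧ g.height j c.1 = c.2}

/-- The strand `i` passes at time `t` from strictly above to strictly below the strand `j`. -/
def Descends (i j : Fin n) (t : unitInterval) : Prop :=
  (∀ᶠ s in 𝓝[<] t, g.height j s < g.height i s) ∧
    (∀ᶠ s in 𝓝[>] t, g.height i s < g.height j s)

/-- The drawing is a braid diagram (multi-crossings being allowed): there are finitely many crossings,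
and any two strands that meet at a crossing pass through each other there (equivalently, each strand
through a crossing bisects it: as many other arms emanate on its one side as on its other side). -/
structure IsDiagram : Prop where
  finite : g.crossings.Finite
  transverse : ∀ i j t, i ≠ j → g.height i t = g.height j t → g.Descends i j t ∨ g.Descends j i t

/-- A star diagram: a braid diagram that is connected and has exactly one crossing. -/
structure IsStarDiagram : Prop extends g.IsDiagram where
  connected : IsConnected g.drawing
  single : ∃! c, c ∈ g.crossings

end GeometricBraid

/-- A braid admits a star diagram if some geometric braid that represents it projects to one. -/
def AdmitsStarDiagram {n : ℕ} (b : BraidGroup n) : Prop :=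
  ∃ g : GeometricBraid n, g.IsStarDiagram ∧ g.toBraid = b

/-! ### Simple braids and the half-twist -/

/-- The drawing joins position `i` to position `π i` by a straight segment, so that two strands cross
at most once. For `i < j`, the strand `i` starts above the strand `j` and has the greater `z`; so if
the two cross, the overstrand descends from left to right, that is, the crossing is positive. -/
def simpleGeometric {n : ℕ} (π : Equiv.Perm (Fin n)) : GeometricBraid n where
  strand i :=
    { toFun := fun t => ((1 - (t : ℝ)) * level i + t * level (π i), t * (1 - (t : ℝ)) * level i)
      continuous_toFun := by fun_prop }
  disjoint t i j h := by
    have h1 := congrArg Prod.fst h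
    have h2 := congrArg Prod.snd h
    simp only [ContinuousMap.coe_mk] at h1 h2
    by_cases h0 : (t : ℝ) = 0
    · apply level_injective
      simpa [h0] using h1
    by_cases h3 : 1 - (t : ℝ) = 0
    · have h4 : (t : ℝ) = 1 := by linarith
      apply π.injective
      apply level_injective
      simpa [h4] using h1
    · exact level_injective (mul_left_cancel₀ (mul_ne_zero h0 h3) h2)
  start i := by simp
  finish := ⟨π, fun i => by simp⟩

/-- The simple braid `br(π)`: the positive braid in which any two strands cross at most once and that
takes position `i` to position `π i`. -/
def br {n : ℕ} (π : Equiv.Perm (Fin n)) : BraidGroup n := (simpleGeometric π).toBraid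

/-- The positive half-twist as a motion: the row of `n` points is rotated rigidly by the angle `π`
about its midpoint, the upper strands passing in front. -/
def halfTwistGeometric (n : ℕ) : GeometricBraid n where
  strand i :=
    { toFun := fun t =>
        (-((n : ℝ) - 1) / 2 + (level i + ((n : ℝ) - 1) / 2) * Real.cos (Real.pi * t),
          (level i + ((n : ℝ) - 1) / 2) * Real.sin (Real.pi * t))
      continuous_toFun := by fun_prop }
  disjoint t i j h := by
    have h1 := congrArg Prod.fst h
    have h2 := congrArg Prod.snd h
    simp only [ContinuousMap.coe_mk] at h1 h2
    apply level_injective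
    have h3 := Real.sin_sq_add_cos_sq (Real.pi * t)
    linear_combination Real.cos (Real.pi * t) * h1 + Real.sin (Real.pi * t) * h2
      - (level i - level j) * h3
  start i := by
    simp
    ring
  finish := ⟨Fin.revPerm, fun i => by
    have h : ((Fin.rev i : Fin n) : ℝ) = (n : ℝ) - (i + 1) := by
      rw [Fin.val_rev, Nat.cast_sub i.isLt]
      push_cast
      ring
    simp [level]
    ring⟩

/-- The positive half-twist `Δ_n`. -/
def halfTwist (n : ℕ) : BraidGroup n := (halfTwistGeometric n).toBraid

end Braid

end

/-!
The idea is that all homotopies that are needed can be taken to be straight-line homotopies of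
*ordered* configurations. Such a homotopy keeps the points distinct as soon as, for every pair of
points at every time, the difference vectors of the pair in the two motions are not opposite; this
is checked pair by pair with the height or the depth as a separating functional
(`homotopic_of_separated`).

In a star diagram, connectedness forces every strand through the only crossing. So the heights of
the strands are in their initial order before the crossing and in the opposite order after it, and
at the crossing the points stand one behind the other, in a column, in some order `π` of the depths.
Let `q σ` (`quarterTurn σ`) be the straight motion from the row of standard points to the column,
taking position `i` to depth `σ i`, and let `w` be the reversal. Then, in the order of motion,
* a star diagram with order `π` is `q π` followed by the inverse of `q (π w)`
  (`GeometricBraid.IsStarDiagram.homotopic`);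
* `br π` is `q π` followed by the inverse of `q 1` (`simpleGeometric_homotopic`);
* `Δ` is `q w` followed by the inverse of `q 1` (`halfTwistGeometric_homotopic`);
* the inverse of `q (π w)` followed by `q w` is homotopic to the inverse of `q 1` followed by
  `q π⁻¹` (`quarterTurn_symm_trans_homotopic`).

Thus a star diagram followed by `Δ` is `q π`, `(q 1)⁻¹`, `q π⁻¹`, `(q 1)⁻¹`, that is, `br π` followed
by `br π⁻¹`. Conversely, every `π` is the order of the depths in some star diagram, for instance in
`starGeometric π`.
-/

namespace Braid

/-! ### Straight-line homotopies of ordered configurations -/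

theorem level_lt_level {n : ℕ} {i j : Fin n} : level j < level i ↔ i < j := by
  simp [level]

/-- Two motions of ordered configurations with the same ends are homotopic if at each time, and for
each pair of points, some linear functional orders the pair in the same way in both motions, strictly
in at least one of them: the difference vectors of the pair are then never opposite, so that the
points stay distinct along the straight-line homotopy. -/
theorem homotopic_of_separated {n : ℕ} {p q : OrdConf n} (P Q : Path p q)
    (h : ∀ t : unitInterval, 0 < (t : ℝ) → (t : ℝ) < 1 → ∀ i j : Fin n, i < j → ∃ a b : ℝ,
      (a * ((P t).1 j).1 + b * ((P t).1 j).2 < a * ((P t).1 i).1 + b * ((P t).1 i).2 ∧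
        a * ((Q t).1 j).1 + b * ((Q t).1 j).2 ≤ a * ((Q t).1 i).1 + b * ((Q t).1 i).2) ∨
      (a * ((P t).1 j).1 + b * ((P t).1 j).2 ≤ a * ((P t).1 i).1 + b * ((P t).1 i).2 ∧
        a * ((Q t).1 j).1 + b * ((Q t).1 j).2 < a * ((Q t).1 i).1 + b * ((Q t).1 i).2)) :
    P.Homotopic Q := by
  -- An equality of two points along the straight-line homotopy contradicts the separation, or, at the
  -- ends of the homotopy and of the motions, the injectivity of a configuration.
  have ne (x : unitInterval × unitInterval) {i j : Fin n} (hij : i < j) :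
      (1 - (x.1 : ℝ)) • (P x.2).1 i + (x.1 : ℝ) • (Q x.2).1 i ≠
        (1 - (x.1 : ℝ)) • (P x.2).1 j + (x.1 : ℝ) • (Q x.2).1 j := by
    obtain ⟨s, t⟩ := x
    intro e
    have endpoint : P t = Q t → False := fun hPQ => by
      rw [← hPQ, ← add_smul, ← add_smul, sub_add_cancel, one_smul, one_smul] at e
      exact hij.ne ((P t).2 e)
    rcases t.2.1.eq_or_lt with h0 | h0
    · have : t = 0 := Subtype.ext h0.symm
      exact endpoint (by simp [this])
    rcases t.2.2.eq_or_lt with h1 | h1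
    · have : t = 1 := Subtype.ext h1
      exact endpoint (by simp [this])
    have e1 := congrArg Prod.fst e
    have e2 := congrArg Prod.snd e
    simp only [Prod.fst_add, Prod.snd_add, Prod.smul_fst, Prod.smul_snd, smul_eq_mul] at e1 e2
    by_cases hs0 : (s : ℝ) = 0
    · exact hij.ne ((P t).2 (by simpa [hs0] using e))
    by_cases hs1 : (s : ℝ) = 1
    · exact hij.ne ((Q t).2 (by simpa [hs1] using e))
    have s0 : 0 < (s : ℝ) := lt_of_le_of_ne s.2.1 (Ne.symm hs0)
    have s1 : 0 < 1 - (s : ℝ) := sub_pos.2 (lt_of_le_of_ne s.2.2 hs1)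
    obtain ⟨a, b, ⟨hP, hQ⟩ | ⟨hP, hQ⟩⟩ := h t h0 h1 i j hij
    · have k1 := mul_lt_mul_of_pos_left hP s1
      have k2 := mul_le_mul_of_nonneg_left hQ s0.le
      have k3 := congrArg (a * ·) e1
      have k4 := congrArg (b * ·) e2
      linarith
    · have k1 := mul_le_mul_of_nonneg_left hP s1.le
      have k2 := mul_lt_mul_of_pos_left hQ s0
      have k3 := congrArg (a * ·) e1
      have k4 := congrArg (b * ·) e2
      linarith
  refine ⟨{
    toFun x := ⟨fun i => (1 - (x.1 : ℝ)) • (P x.2).1 i + (x.1 : ℝ) • (Q x.2).1 i, ?_⟩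
    continuous_toFun := ?_
    map_zero_left t := ?_
    map_one_left t := ?_
    prop' s t ht := ?_ }⟩
  · intro i j e
    rcases lt_trichotomy i j with hij | hij | hij
    · exact (ne x hij e).elim
    · exact hij
    · exact (ne x hij e.symm).elim
  · refine Continuous.subtype_mk (continuous_pi fun i => ?_) _
    have hP : Continuous fun x : unitInterval × unitInterval => (P x.2).1 i :=
      (continuous_apply i).comp (continuous_subtype_val.comp (P.continuous.comp continuous_snd))
    have hQ : Continuous fun x : unitInterval × unitInterval => (Q x.2).1 i :=
      (continuous_apply i).comp (continuous_subtype_val.comp (Q.continuous.comp continuous_snd))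
    have hs : Continuous fun x : unitInterval × unitInterval => (x.1 : ℝ) := by fun_prop
    exact ((continuous_const.sub hs).smul hP).add (hs.smul hQ)
  · simp
  · simp
  · have hPQ : P t = Q t := by
      rcases ht with rfl | ht
      · simp
      · rw [Set.mem_singleton_iff.1 ht]
        simp
    refine Subtype.ext (funext fun i => ?_)
    change (1 - (s : ℝ)) • (P t).1 i + (s : ℝ) • (Q t).1 i = (P t).1 i
    rw [← hPQ, ← add_smul, sub_add_cancel, one_smul]

/-! ### Lifts to ordered configurations -/

/-- The path `P` of ordered configurations lifts the path `γ` of `n`-element subsets. -/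
def Lifts {n : ℕ} {p q : OrdConf n} (P : Path p q) {x y : Conf n} (γ : Path x y) : Prop :=
  ∀ t, (⟦P t⟧ : Conf n) = γ t

namespace Lifts

variable {n : ℕ} {p q r : OrdConf n} {x y z : Conf n}

theorem symm {P : Path p q} {γ : Path x y} (h : Lifts P γ) : Lifts P.symm γ.symm :=
  fun t => h (unitInterval.symm t)

theorem trans {P : Path p q} {Q : Path q r} {γ : Path x y} {δ : Path y z} (hP : Lifts P γ)
    (hQ : Lifts Q δ) : Lifts (P.trans Q) (γ.trans δ) := by
  intro t
  rw [Path.trans_apply, Path.trans_apply]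
  split_ifs
  · exact hP _
  · exact hQ _

theorem homotopic {P Q : Path p q} {γ δ : Path x y} (hP : Lifts P γ) (hQ : Lifts Q δ)
    (h : P.Homotopic Q) : γ.Homotopic δ := by
  have hx := hP 0
  have hy := hP 1
  simp only [Path.source, Path.target] at hx hy
  subst hx hy
  have e (R : Path p q) {ε : Path (⟦p⟧ : Conf n) ⟦q⟧} (hR : Lifts R ε) :
      R.map continuous_quotient_mk' = ε := Path.ext (funext hR)
  rw [← e P hP, ← e Q hQ]
  exact h.map ⟨_, continuous_quotient_mk'⟩

end Lifts

/-! ### Quarter turns -/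

/-- The points of the base configuration, the point with the label `i` being at position `ρ i`. -/
def row {n : ℕ} (ρ : Equiv.Perm (Fin n)) : OrdConf n :=
  ⟨fun i => (level (ρ i), 0), fun _ _ h => ρ.injective (level_injective (congrArg Prod.fst h))⟩

/-- The points `(0, k)`, one behind the other in the drawing, the point with the label `i` being at
depth `σ i`. -/
def column {n : ℕ} (σ : Equiv.Perm (Fin n)) : OrdConf n :=
  ⟨fun i => (0, (σ i : ℝ)), fun i j h => by
    have h2 : (σ i : ℝ) = σ j := congrArg Prod.snd h
    exact σ.injective (Fin.ext (by exact_mod_cast h2))⟩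

/-- The straight motion from the row to the column; the point with the label `i` moves from
position `ρ i` to depth `σ i`. -/
def quarter {n : ℕ} (ρ σ : Equiv.Perm (Fin n)) : Path (row ρ) (column σ) where
  toFun t := ⟨fun i => ((1 - (t : ℝ)) * level (ρ i), t * (σ i : ℝ)), fun i j h => by
    have h1 := congrArg Prod.fst h
    have h2 := congrArg Prod.snd h
    simp only at h1 h2
    by_cases h0 : 1 - (t : ℝ) = 0
    · have h4 : (t : ℝ) = 1 := by linarith
      rw [h4, one_mul, one_mul] at h2
      exact σ.injective (Fin.ext (by exact_mod_cast h2))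
    · exact ρ.injective (level_injective (mul_left_cancel₀ h0 h1))⟩
  continuous_toFun := by
    refine Continuous.subtype_mk (continuous_pi fun i => ?_) _
    fun_prop
  source' := by simp [row]
  target' := by simp [column]

/-- The `n`-element set `{(0, 0), …, (0, n - 1)}`. -/
def columnConf (n : ℕ) : Conf n := ⟦column 1⟧

theorem mk_row {n : ℕ} (ρ : Equiv.Perm (Fin n)) : (⟦row ρ⟧ : Conf n) = base n :=
  Quotient.sound ⟨ρ⁻¹, fun i => by simp [row, baseOrd]⟩

theorem mk_column {n : ℕ} (σ : Equiv.Perm (Fin n)) : (⟦column σ⟧ : Conf n) = columnConf n :=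
  Quotient.sound ⟨σ⁻¹, fun i => by simp [column]⟩

/-- The path of `n`-element subsets from the row to the column that takes position `i` to
depth `σ i`. -/
def quarterTurn {n : ℕ} (σ : Equiv.Perm (Fin n)) : Path (base n) (columnConf n) :=
  ((quarter 1 σ).map continuous_quotient_mk').cast (mk_row 1).symm (mk_column σ).symm

/-- The path of subsets traced out by `quarter ρ τ` depends only on the permutation that takes
positions to depths. -/
theorem lifts_quarter {n : ℕ} {ρ σ τ : Equiv.Perm (Fin n)} (h : τ = σ * ρ) :
    Lifts (quarter ρ τ) (quarterTurn σ) := by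
  subst h
  exact fun t => Quotient.sound ⟨ρ⁻¹, fun i => by simp [quarter]⟩

theorem quarter_apply {n : ℕ} (ρ σ : Equiv.Perm (Fin n)) (t : unitInterval) (i : Fin n) :
    (quarter ρ σ t).1 i = ((1 - (t : ℝ)) * level (ρ i), t * (σ i : ℝ)) := rfl

theorem quarter_symm_apply {n : ℕ} (ρ σ : Equiv.Perm (Fin n)) (t : unitInterval) (i : Fin n) :
    ((quarter ρ σ).symm t).1 i = ((t : ℝ) * level (ρ i), (1 - (t : ℝ)) * (σ i : ℝ)) := by
  simp [Path.symm_apply, quarter_apply]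

/-- From the row to the column and back. -/
theorem quarter_trans_quarter_symm_apply {n : ℕ} (ρ σ τ : Equiv.Perm (Fin n)) (t : unitInterval)
    (i : Fin n) : (((quarter ρ σ).trans (quarter τ σ).symm) t).1 i =
      if (t : ℝ) ≤ 1 / 2 then ((1 - 2 * (t : ℝ)) * level (ρ i), 2 * (t : ℝ) * (σ i : ℝ))
      else ((2 * (t : ℝ) - 1) * level (τ i), (2 - 2 * (t : ℝ)) * (σ i : ℝ)) := by
  rw [Path.trans_apply]
  split_ifs
  · rw [quarter_apply]
  · rw [quarter_symm_apply]
    congr 2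
    ring

/-- From the column to the row and back. -/
theorem quarter_symm_trans_quarter_apply {n : ℕ} (ρ σ τ : Equiv.Perm (Fin n)) (t : unitInterval)
    (i : Fin n) : (((quarter ρ σ).symm.trans (quarter ρ τ)) t).1 i =
      if (t : ℝ) ≤ 1 / 2 then (2 * (t : ℝ) * level (ρ i), (1 - 2 * (t : ℝ)) * (σ i : ℝ))
      else ((2 - 2 * (t : ℝ)) * level (ρ i), (2 * (t : ℝ) - 1) * (τ i : ℝ)) := by
  rw [Path.trans_apply]
  split_ifs
  · rw [quarter_symm_apply]
  · rw [quarter_apply]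
    congr 2
    ring

/-! ### Lifting geometric braids -/

namespace GeometricBraid

variable {n : ℕ} (g : GeometricBraid n)

/-- The motion of the strands of a geometric braid that takes position `i` to position `ρ i`. -/
def motion {ρ : Equiv.Perm (Fin n)} (h : ∀ i, g.strand i 1 = (level (ρ i), 0)) :
    Path (row 1) (row ρ) where
  toFun t := ⟨fun i => g.strand i t, g.disjoint t⟩
  continuous_toFun :=
    Continuous.subtype_mk (continuous_pi fun i => (g.strand i).continuous) _
  source' := Subtype.ext (funext g.start)
  target' := Subtype.ext (funext h)

theorem lifts_motion {ρ : Equiv.Perm (Fin n)} (h : ∀ i, g.strand i 1 = (level (ρ i), 0)) :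
    Lifts (g.motion h) g.toLoop := fun _ => rfl

end GeometricBraid

variable {n : ℕ}

/-! ### Decomposition of simple braids and of the half-twist into quarter turns -/

theorem cast_lt_cast {i j : Fin n} (h : i < j) : (i : ℝ) < (j : ℝ) := by exact_mod_cast h

/-- A simple braid is a quarter turn to a column followed by a quarter turn back. A pair that
crosses moves in the half-plane where its upper strand is in front, throughout; a pair that does not
cross keeps its order in height. -/
theorem simpleGeometric_homotopic (π : Equiv.Perm (Fin n)) :
    (simpleGeometric π).toLoop.Homotopic ((quarterTurn π).trans (quarterTurn 1).symm) := by
  have hπ : ∀ i, (simpleGeometric π).strand i 1 = (level (π i), 0) := fun i => by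
    simp [simpleGeometric]
  refine ((simpleGeometric π).lifts_motion hπ).homotopic
    ((lifts_quarter (ρ := 1) (τ := π) (mul_one π).symm).trans
      (lifts_quarter (ρ := π) (τ := π) (one_mul π).symm).symm)
    (homotopic_of_separated _ _ fun t h0 h1 i j hij => ?_)
  simp only [quarter_trans_quarter_symm_apply, Equiv.Perm.one_apply]
  have hl := level_lt_level.2 hij
  rcases lt_or_gt_of_ne (π.injective.ne hij.ne) with hc | hc
  · refine ⟨1, 0, Or.inl ⟨?_, ?_⟩⟩
    · have hc' := level_lt_level.2 hc
      simp only [GeometricBraid.motion, simpleGeometric, Path.coe_mk', ContinuousMap.coe_mk]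
      nlinarith
    · have hc' := level_lt_level.2 hc
      split_ifs <;> simp only <;> nlinarith
  · refine ⟨0, 1, Or.inl ⟨?_, ?_⟩⟩
    · have := mul_pos h0 (sub_pos.2 h1)
      simp only [GeometricBraid.motion, simpleGeometric, Path.coe_mk', ContinuousMap.coe_mk]
      nlinarith
    · have hc' := cast_lt_cast hc
      split_ifs <;> simp only <;> nlinarith

theorem level_rev (i : Fin n) : level (Fin.rev i) = -((n : ℝ) - 1) - level i := by
  rw [level, level, Fin.val_rev, Nat.cast_sub i.isLt]
  push_cast
  ring

/-- The half-twist turns the row to a column and further to the reversed row; the upper strand of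
each pair is in front, throughout. -/
theorem halfTwistGeometric_homotopic :
    (halfTwistGeometric n).toLoop.Homotopic
      ((quarterTurn Fin.revPerm).trans (quarterTurn 1).symm) := by
  have hr : ∀ i, (halfTwistGeometric n).strand i 1 = (level (Fin.revPerm i), 0) := fun i => by
    rw [Fin.revPerm_apply, level_rev]
    simp only [halfTwistGeometric, ContinuousMap.coe_mk, Set.Icc.coe_one, mul_one,
      Real.cos_pi, Real.sin_pi, mul_zero]
    congr 1
    ring
  refine ((halfTwistGeometric n).lifts_motion hr).homotopic
    ((lifts_quarter (ρ := 1) (mul_one _).symm).trans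
      (lifts_quarter (ρ := Fin.revPerm) (one_mul _).symm).symm)
    (homotopic_of_separated _ _ fun t h0 h1 i j hij => ⟨0, 1, Or.inl ⟨?_, ?_⟩⟩)
  · have hl := level_lt_level.2 hij
    have hs : 0 < Real.sin (Real.pi * t) :=
      Real.sin_pos_of_pos_of_lt_pi (mul_pos Real.pi_pos h0) (by nlinarith [Real.pi_pos])
    simp only [GeometricBraid.motion, halfTwistGeometric, Path.coe_mk', ContinuousMap.coe_mk]
    nlinarith
  · have hc := cast_lt_cast (Fin.rev_lt_rev.2 hij)
    simp only [quarter_trans_quarter_symm_apply, Fin.revPerm_apply]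
    split_ifs <;> simp only <;> nlinarith

/-! ### Two motions between columns -/

/-- A motion from the column with the order `π` to the column in the standard order. Two points that
have to change their order in depth do so while the one with the smaller label is the lower one. -/
def columnMotion (π : Equiv.Perm (Fin n)) : Path (column π) (column 1) where
  toFun t := ⟨fun i => ((t : ℝ) * (1 - t) * level (Fin.rev i),
    (1 - (t : ℝ)) * (π i : ℝ) + t * (i : ℝ)), fun i j h => by
    have h1 := congrArg Prod.fst h
    have h2 := congrArg Prod.snd h
    simp only at h1 h2
    by_cases h0 : (t : ℝ) = 0
    · rw [h0] at h2
      exact π.injective (Fin.ext (by simpa using h2))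
    by_cases h3 : 1 - (t : ℝ) = 0
    · have h4 : (t : ℝ) = 1 := by linarith
      rw [h4] at h2
      exact Fin.ext (by simpa using h2)
    · exact Fin.rev_injective (level_injective (mul_left_cancel₀ (mul_ne_zero h0 h3) h1))⟩
  continuous_toFun := by
    refine Continuous.subtype_mk (continuous_pi fun i => ?_) _
    fun_prop
  source' := by simp [column]
  target' := by simp [column]

theorem columnMotion_apply (π : Equiv.Perm (Fin n)) (t : unitInterval) (i : Fin n) :
    (columnMotion π t).1 i =
      ((t : ℝ) * (1 - t) * level (Fin.rev i), (1 - (t : ℝ)) * (π i : ℝ) + t * (i : ℝ)) := rfl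

/-- Passing from the column with the order `π` to the column in the standard order through the
reversed row, or through the row with the order `π`, comes to the same: in both cases, the pairs
that change their order in depth do so with the smaller label below, and the other pairs keep
their order in depth. -/
theorem quarterTurn_symm_trans_homotopic (π : Equiv.Perm (Fin n)) :
    ((quarterTurn (π * Fin.revPerm)).symm.trans (quarterTurn Fin.revPerm)).Homotopic
      ((quarterTurn 1).symm.trans (quarterTurn π⁻¹)) := by
  have hrev : (Fin.revPerm * Fin.revPerm : Equiv.Perm (Fin n)) = 1 := by
    ext i
    simp
  refine ((lifts_quarter (ρ := Fin.revPerm) (τ := π) ?_).symm.trans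
    (lifts_quarter (ρ := Fin.revPerm) (τ := 1) hrev.symm)).homotopic
    ((lifts_quarter (ρ := π) (τ := π) (one_mul π).symm).symm.trans
      (lifts_quarter (ρ := π) (τ := 1) (inv_mul_cancel π).symm))
    (Path.Homotopic.trans (p₁ := columnMotion π) ?_ (Path.Homotopic.symm ?_))
  · rw [mul_assoc, hrev, mul_one]
  all_goals
    refine homotopic_of_separated _ _ fun t h0 h1 i j hij => ?_
    have ht := mul_pos h0 (sub_pos.2 h1)
    have hij' := cast_lt_cast hij
    have hr := level_lt_level.2 (Fin.rev_lt_rev.2 hij)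
    simp only [quarter_symm_trans_quarter_apply, columnMotion_apply,
      Equiv.Perm.one_apply, Fin.revPerm_apply]
    rcases lt_or_gt_of_ne (π.injective.ne hij.ne) with hc | hc
    · have hc' := cast_lt_cast hc
      refine ⟨0, -1, Or.inr ⟨?_, ?_⟩⟩
      · split_ifs <;> simp only <;> nlinarith
      · nlinarith
    · have hc' := level_lt_level.2 hc
      refine ⟨-1, 0, Or.inr ⟨?_, ?_⟩⟩
      · split_ifs <;> simp only <;> nlinarith
      · nlinarith

/-! ### The shape of a star diagram -/

namespace GeometricBraid

variable (g : GeometricBraid n)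

theorem continuous_height (i : Fin n) : Continuous (g.height i) :=
  continuous_fst.comp (g.strand i).continuous

theorem height_zero (i : Fin n) : g.height i 0 = level i := by
  simp [height, g.start]

theorem height_injective_zero : Function.Injective fun i => g.height i 0 := by
  intro i j h
  simp only [height_zero] at h
  exact level_injective h

theorem height_injective_one : Function.Injective fun i => g.height i 1 := by
  obtain ⟨ρ, h⟩ := g.finish
  intro i j e
  simp only [height, h] at e
  exact ρ.injective (level_injective e)

/-- The order in height of two strands cannot change where they do not meet. -/
theorem height_lt_of_ordConnected {s : Set unitInterval} (hs : s.OrdConnected) {i j : Fin n}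
    (hne : ∀ t ∈ s, g.height i t ≠ g.height j t) {a : unitInterval} (ha : a ∈ s)
    (hlt : g.height j a < g.height i a) {t : unitInterval} (ht : t ∈ s) :
    g.height j t < g.height i t := by
  by_contra! hle
  obtain ⟨u, hu, e⟩ := hs.isPreconnected.intermediate_value₂ ht ha
    (g.continuous_height i).continuousOn (g.continuous_height j).continuousOn hle hlt.le
  exact hne u hu e

/-- If a connected drawing has just one crossing, all strands pass through it: a strand that does
not would be separated from the others. -/
theorem IsStarDiagram.height_eq (hg : g.IsStarDiagram) {c : unitInterval × ℝ}
    (hc : c ∈ g.crossings) (k : Fin n) : g.height k c.1 = c.2 := by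
  by_contra hk
  obtain ⟨i, j, hij, hi, hj⟩ := hc
  have closed (l : Fin n) : IsClosed (Set.range fun t => (t, g.height l t)) :=
    (isCompact_range (continuous_id.prodMk (g.continuous_height l))).isClosed
  have hki : i ≠ k := fun h => hk (h ▸ hi)
  obtain ⟨x, -, ⟨t, rfl⟩, hx⟩ := isPreconnected_closed_iff.1 hg.connected.isPreconnected
    (Set.range fun t => (t, g.height k t))
    (⋃ l ∈ {l | l ≠ k}, Set.range fun t => (t, g.height l t)) (closed k)
    ((Set.toFinite _).isClosed_biUnion fun l _ => closed l)
    (by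
      intro x hx
      obtain ⟨l, hl⟩ := Set.mem_iUnion.1 hx
      by_cases h : l = k
      · exact Or.inl (h ▸ hl)
      · exact Or.inr (Set.mem_biUnion (show l ∈ {l | l ≠ k} from h) hl))
    ⟨(0, g.height k 0), Set.mem_iUnion.2 ⟨k, 0, rfl⟩, 0, rfl⟩
    ⟨(0, g.height i 0), Set.mem_iUnion.2 ⟨i, 0, rfl⟩,
      Set.mem_biUnion (show i ∈ {l | l ≠ k} from hki) ⟨0, rfl⟩⟩
  obtain ⟨l, hl, u, hu⟩ := Set.mem_iUnion₂.1 hx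
  obtain rfl : u = t := congrArg Prod.fst hu
  have hcross : (u, g.height k u) ∈ g.crossings := ⟨l, k, hl, congrArg Prod.snd hu, rfl⟩
  have hcc : c ∈ g.crossings := ⟨i, j, hij, hi, hj⟩
  have e := hg.single.unique hcc hcross
  exact hk (by rw [e])

/-- In a star diagram, all strands meet at one time `t₀`; earlier, they are in their initial order,
and later, in the opposite order. -/
theorem IsStarDiagram.exists_time (hg : g.IsStarDiagram) :
    ∃ t₀ : unitInterval, 0 < t₀ ∧ t₀ < 1 ∧ (∀ i j, g.height i t₀ = g.height j t₀) ∧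
      ∀ i j, i < j → (∀ t < t₀, g.height j t < g.height i t) ∧
        ∀ t > t₀, g.height i t < g.height j t := by
  obtain ⟨c, hc, huniq⟩ := hg.single
  have hall := IsStarDiagram.height_eq g hg hc
  obtain ⟨k, l, hkl, hk, hl⟩ := hc
  have h0 : 0 < c.1 := by
    refine lt_of_le_of_ne unitInterval.nonneg' fun h => hkl (g.height_injective_zero ?_)
    simp only [h, hk, hl]
  have h1 : c.1 < 1 := by
    refine lt_of_le_of_ne unitInterval.le_one' fun h => hkl (g.height_injective_one ?_)
    simp only [← h, hk, hl]
  have hne (i j : Fin n) (hij : i ≠ j) (t : unitInterval) (ht : t ≠ c.1) :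
      g.height i t ≠ g.height j t := fun h =>
    ht (congrArg Prod.fst (huniq (t, g.height j t) ⟨i, j, hij, h, rfl⟩))
  refine ⟨c.1, h0, h1, fun i j => by rw [hall, hall], fun i j hij => ?_⟩
  have hbefore : ∀ t < c.1, g.height j t < g.height i t := fun t ht =>
    g.height_lt_of_ordConnected Set.ordConnected_Iio (fun u hu => hne i j hij.ne u (ne_of_lt hu))
      (a := 0) h0 (by simpa [height_zero] using level_lt_level.2 hij) ht
  refine ⟨hbefore, fun t ht => ?_⟩
  have : (𝓝[<] c.1).NeBot := nhdsLT_neBot_of_exists_lt ⟨0, h0⟩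
  have : (𝓝[>] c.1).NeBot := nhdsGT_neBot_of_exists_gt ⟨1, h1⟩
  rcases hg.transverse i j c.1 hij.ne (by rw [hall, hall]) with hd | hd
  · obtain ⟨a, hlt, ha⟩ := (hd.2.and self_mem_nhdsWithin).exists
    exact g.height_lt_of_ordConnected Set.ordConnected_Ioi
      (fun u hu => hne j i hij.ne' u (ne_of_gt hu)) ha hlt ht
  · obtain ⟨a, hlt, ha⟩ := (hd.1.and self_mem_nhdsWithin).exists
    exact ((hbefore a ha).asymm hlt).elim

end GeometricBraid

/-- A permutation that reverses the order is the reversal. -/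
theorem eq_revPerm_of_strictAnti {ρ : Equiv.Perm (Fin n)} (h : StrictAnti ρ) :
    ρ = Fin.revPerm := by
  have hmono : StrictMono fun i => Fin.rev (ρ i) := fun i j hij => Fin.rev_lt_rev.2 (h hij)
  have hid : (fun i => Fin.rev (ρ i)) = id :=
    congrArg DFunLike.coe (Subsingleton.elim
      (hmono.orderIsoOfSurjective _ (Fin.rev_surjective.comp ρ.surjective)) (OrderIso.refl (Fin n)))
  ext i
  have := congrFun hid i
  simp only [id] at this
  rw [Fin.revPerm_apply, ← this, Fin.rev_rev, this]

/-- A reparametrisation of the unit interval that takes `a` to `1 / 2`. -/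
theorem exists_reparam {a : unitInterval} (h0 : 0 < a) (h1 : a < 1) :
    ∃ θ : unitInterval → unitInterval, Continuous θ ∧ θ 0 = 0 ∧ θ 1 = 1 ∧
      (∀ t < a, (θ t : ℝ) < 1 / 2) ∧ (θ a : ℝ) = 1 / 2 ∧ ∀ t > a, 1 / 2 < (θ t : ℝ) := by
  have a0 : 0 < (a : ℝ) := h0
  have a1 : 0 < 1 - (a : ℝ) := sub_pos.2 h1
  -- The Möbius transformation that fixes `0` and `1` and takes `a` to `1 / 2`.
  have hden (t : unitInterval) : 0 < (t : ℝ) * (1 - a) + (1 - t) * a := by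
    rcases t.2.1.eq_or_lt with ht | ht
    · simpa [← ht] using a0
    · exact add_pos_of_pos_of_nonneg (mul_pos ht a1) (mul_nonneg (sub_nonneg.2 t.2.2) a0.le)
  refine ⟨fun t => ⟨t * (1 - a) / (t * (1 - a) + (1 - t) * a), ?_, ?_⟩, ?_, ?_, ?_, ?_, ?_, ?_⟩
  · exact div_nonneg (mul_nonneg t.2.1 a1.le) (hden t).le
  · rw [div_le_one (hden t)]
    nlinarith [t.2.2]
  · refine Continuous.subtype_mk (Continuous.div ?_ ?_ fun t => (hden t).ne') _ <;> fun_prop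
  · simp
  · ext
    simp [a1.ne']
  · intro t ht
    have ht' : (t : ℝ) < a := ht
    rw [div_lt_div_iff₀ (hden t) two_pos]
    nlinarith
  · rw [div_eq_div_iff (hden a).ne' two_ne_zero]
    ring
  · intro t ht
    have ht' : (a : ℝ) < t := ht
    rw [div_lt_div_iff₀ two_pos (hden t)]
    nlinarith

/-- A star diagram is a quarter turn to a column, whose order is the order in depth at the crossing,
followed by a quarter turn to the reversed row. -/
theorem GeometricBraid.IsStarDiagram.homotopic {g : GeometricBraid n} (hg : g.IsStarDiagram) :
    ∃ t₀ : unitInterval, 0 < t₀ ∧ t₀ < 1 ∧ (∀ i j, g.height i t₀ = g.height j t₀) ∧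
      ∀ π : Equiv.Perm (Fin n),
        (∀ i j, π i < π j → (g.strand i t₀).2 < (g.strand j t₀).2) →
        g.toLoop.Homotopic ((quarterTurn π).trans (quarterTurn (π * Fin.revPerm)).symm) := by
  obtain ⟨t₀, h0, h1, heq, hlt⟩ := IsStarDiagram.exists_time g hg
  refine ⟨t₀, h0, h1, heq, fun π hπ => ?_⟩
  obtain ⟨ρ, hρ⟩ := g.finish
  obtain rfl : ρ = Fin.revPerm := eq_revPerm_of_strictAnti fun i j hij => by
    have := (hlt i j hij).2 1 h1
    simpa [height, hρ, level_lt_level] using this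
  obtain ⟨θ, hθ, hθ0, hθ1, hθlt, hθeq, hθgt⟩ := exists_reparam h0 h1
  let Q := ((quarter 1 π).trans (quarter Fin.revPerm π).symm).reparam θ hθ hθ0 hθ1
  let γ := ((quarterTurn π).trans (quarterTurn (π * Fin.revPerm)).symm)
  have hQ : Lifts Q (γ.reparam θ hθ hθ0 hθ1) := fun t =>
    ((lifts_quarter (ρ := 1) (mul_one π).symm).trans
      (lifts_quarter (ρ := Fin.revPerm) (by ext i; simp)).symm) (θ t)
  have hrep : γ.Homotopic (γ.reparam θ hθ hθ0 hθ1) := ⟨Path.Homotopy.reparam γ θ hθ hθ0 hθ1⟩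
  refine ((g.lifts_motion hρ).homotopic hQ
    (homotopic_of_separated _ _ fun t ht0 ht1 i j hij => ?_)).trans hrep.symm
  have hl := level_lt_level.2 hij
  have hr := level_lt_level.2 (Fin.rev_lt_rev.2 hij)
  have hQt (k : Fin n) : (Q t).1 k =
      if (θ t : ℝ) ≤ 1 / 2 then ((1 - 2 * (θ t : ℝ)) * level k, 2 * (θ t : ℝ) * (π k : ℝ))
      else ((2 * (θ t : ℝ) - 1) * level (Fin.rev k), (2 - 2 * (θ t : ℝ)) * (π k : ℝ)) :=
    quarter_trans_quarter_symm_apply 1 π Fin.revPerm (θ t) k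
  have hPt (k : Fin n) : (g.motion hρ t).1 k = g.strand k t := rfl
  simp only [hQt, hPt]
  -- Before the crossing, the heights separate a pair; at the crossing, the depths do; and after it,
  -- again the heights, in the opposite order.
  rcases lt_trichotomy t t₀ with ht | rfl | ht
  · have hb := (hlt i j hij).1 t ht
    have hθt := hθlt t ht
    refine ⟨1, 0, Or.inl ⟨by simpa [height] using hb, ?_⟩⟩
    simp only [hθt.le, if_true]
    nlinarith
  · have he := heq i j
    simp only [height] at he
    simp only [hθeq, le_refl, if_true]
    rcases lt_or_gt_of_ne (π.injective.ne hij.ne) with hc | hc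
    · have hc' := cast_lt_cast hc
      refine ⟨0, -1, Or.inl ⟨by linarith [hπ i j hc], by linarith⟩⟩
    · have hc' := cast_lt_cast hc
      refine ⟨0, 1, Or.inl ⟨by linarith [hπ j i hc], by linarith⟩⟩
  · have hb := (hlt i j hij).2 t ht
    have hθt := hθgt t ht
    refine ⟨-1, 0, Or.inl ⟨by simpa [height] using hb, ?_⟩⟩
    simp only [not_le.2 hθt, if_false]
    nlinarith

/-- The depths at the crossing of a star diagram are different, hence put the strands in an order. -/
theorem exists_perm_of_injective {z : Fin n → ℝ} (hz : Function.Injective z) :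
    ∃ π : Equiv.Perm (Fin n), ∀ i j, π i < π j → z i < z j := by
  have hm := (Tuple.monotone_sort z).strictMono_of_injective (hz.comp (Tuple.sort z).injective)
  refine ⟨(Tuple.sort z)⁻¹, fun i j hij => ?_⟩
  simpa using hm hij

/-! ### Star diagrams with a given order in depth -/

/-- The braid whose drawing consists of `n` segments that join position `i` to position `n - 1 - i`
and meet at their midpoints, the strands being there in the order `π` in depth. -/
def starGeometric (π : Equiv.Perm (Fin n)) : GeometricBraid n where
  strand i :=
    { toFun := fun t =>
        ((1 - (t : ℝ)) * level i + t * level (Fin.rev i), t * (1 - (t : ℝ)) * (π i : ℝ))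
      continuous_toFun := by fun_prop }
  disjoint t i j h := by
    have h1 := congrArg Prod.fst h
    have h2 := congrArg Prod.snd h
    simp only [ContinuousMap.coe_mk] at h1 h2
    by_cases h0 : (t : ℝ) = 0
    · apply level_injective
      simpa [h0] using h1
    by_cases h3 : 1 - (t : ℝ) = 0
    · have h4 : (t : ℝ) = 1 := by linarith
      apply Fin.rev_injective
      apply level_injective
      simpa [h4] using h1
    · exact π.injective (Fin.ext (by exact_mod_cast mul_left_cancel₀ (mul_ne_zero h0 h3) h2))
  start i := by simp
  finish := ⟨Fin.revPerm, fun i => by simp⟩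

theorem starGeometric_height (π : Equiv.Perm (Fin n)) (i : Fin n) (t : unitInterval) :
    (starGeometric π).height i t = (1 - 2 * (t : ℝ)) * level i - t * ((n : ℝ) - 1) := by
  change (1 - (t : ℝ)) * level i + t * level (Fin.rev i) = _
  rw [level_rev]
  ring

theorem starGeometric_isStarDiagram (hn : 2 ≤ n) (π : Equiv.Perm (Fin n)) :
    (starGeometric π).IsStarDiagram := by
  let m : unitInterval := ⟨1 / 2, by norm_num, by norm_num⟩
  let y : ℝ := -((n : ℝ) - 1) / 2
  have hm (i : Fin n) : (starGeometric π).height i m = y := by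
    rw [starGeometric_height]
    simp only [m, y]
    ring
  have meet {i j : Fin n} {t : unitInterval} (hij : i ≠ j)
      (h : (starGeometric π).height i t = (starGeometric π).height j t) : t = m := by
    rw [starGeometric_height, starGeometric_height] at h
    have h' : (1 - 2 * (t : ℝ)) * (level i - level j) = 0 := by linarith
    rcases mul_eq_zero.1 h' with h' | h'
    · exact Subtype.ext (show (t : ℝ) = 1 / 2 by linarith)
    · exact (hij (level_injective (sub_eq_zero.1 h'))).elim
  have hcross : (starGeometric π).crossings = {(m, y)} := by
    refine Set.eq_singleton_iff_unique_mem.2 ⟨⟨⟨0, by omega⟩, ⟨1, by omega⟩, by simp, hm _, hm _⟩, ?_⟩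
    rintro ⟨t, x⟩ ⟨i, j, hij, hi, hj⟩
    simp only at hi hj
    obtain rfl := meet hij (hi.trans hj.symm)
    rw [← hi, hm]
  have descends {i j : Fin n} (hij : i < j) : (starGeometric π).Descends i j m := by
    have hl := level_lt_level.2 hij
    constructor <;> refine eventually_nhdsWithin_of_forall fun s hs => ?_
    · have hs' : (s : ℝ) < 1 / 2 := hs
      rw [starGeometric_height, starGeometric_height]
      nlinarith
    · have hs' : 1 / 2 < (s : ℝ) := hs
      rw [starGeometric_height, starGeometric_height]
      nlinarith
  refine ⟨⟨hcross ▸ Set.finite_singleton _, fun i j t hij h => ?_⟩, ⟨?_, ?_⟩, (m, y), ?_, ?_⟩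
  · obtain rfl := meet hij h
    rcases lt_or_gt_of_ne hij with h' | h'
    · exact Or.inl (descends h')
    · exact Or.inr (descends h')
  · exact ⟨_, Set.mem_iUnion.2 ⟨⟨0, by omega⟩, 0, rfl⟩⟩
  · exact isPreconnected_iUnion ⟨(m, y), Set.mem_iInter.2 fun i => ⟨m, by simp only [hm]⟩⟩
      fun i => isPreconnected_range
        (continuous_id.prodMk ((starGeometric π).continuous_height i))
  · exact hcross ▸ rfl
  · intro c hc
    exact Set.mem_singleton_iff.1 (hcross ▸ hc)

theorem starGeometric_homotopic (hn : 2 ≤ n) (π : Equiv.Perm (Fin n)) :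
    (starGeometric π).toLoop.Homotopic
      ((quarterTurn π).trans (quarterTurn (π * Fin.revPerm)).symm) := by
  obtain ⟨t₀, h0, h1, -, h⟩ := (starGeometric_isStarDiagram hn π).homotopic
  refine h π fun i j hij => ?_
  have a0 : 0 < (t₀ : ℝ) := h0
  have a1 : 0 < 1 - (t₀ : ℝ) := sub_pos.2 h1
  exact mul_lt_mul_of_pos_left (cast_lt_cast hij) (mul_pos a0 a1)

/-! ### The braid of a star diagram -/

open CategoryTheory in
/-- The composition of two quarter turns that describes a star diagram, in terms of the simple braids
and the half-twist. -/
theorem eq_of_homotopic {g : GeometricBraid n} {π : Equiv.Perm (Fin n)}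
    (h : g.toLoop.Homotopic ((quarterTurn π).trans (quarterTurn (π * Fin.revPerm)).symm)) :
    g.toBraid = (halfTwist n)⁻¹ * br π⁻¹ * br π := by
  let e (σ : Equiv.Perm (Fin n)) :
      FundamentalGroupoid.mk (base n) ⟶ FundamentalGroupoid.mk (columnConf n) :=
    Path.Homotopic.Quotient.mk (quarterTurn σ)
  have hbr (σ : Equiv.Perm (Fin n)) : br σ = e σ ≫ Groupoid.inv (e 1) :=
    Path.Homotopic.Quotient.eq.2 (simpleGeometric_homotopic σ)
  have hΔ : halfTwist n = e Fin.revPerm ≫ Groupoid.inv (e 1) :=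
    Path.Homotopic.Quotient.eq.2 halfTwistGeometric_homotopic
  have hg : g.toBraid = e π ≫ Groupoid.inv (e (π * Fin.revPerm)) :=
    Path.Homotopic.Quotient.eq.2 h
  have hcol : Groupoid.inv (e (π * Fin.revPerm)) ≫ e Fin.revPerm = Groupoid.inv (e 1) ≫ e π⁻¹ :=
    Path.Homotopic.Quotient.eq.2 (quarterTurn_symm_trans_homotopic π)
  -- It remains to see that `g` followed by the half-twist is `br π` followed by `br π⁻¹`. Both sides
  -- are four quarter turns, which differ in the two middle ones only.
  rw [mul_assoc, eq_inv_mul_iff_mul_eq, End.mul_def, End.mul_def, hbr, hbr, hΔ, hg]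
  simp only [Category.assoc]
  rw [reassoc_of% hcol]

end Braid

theorem mainTheorem4 (n : ℕ) (hn : 2 ≤ n) (b : Braid.BraidGroup n) :
    Braid.AdmitsStarDiagram b ↔
      ∃ π : Equiv.Perm (Fin n),
        b = (Braid.halfTwist n)⁻¹ * Braid.br π⁻¹ * Braid.br π := by
  constructor
  · rintro ⟨g, hg, rfl⟩
    obtain ⟨t₀, -, -, heq, h⟩ := hg.homotopic
    obtain ⟨π, hπ⟩ := Braid.exists_perm_of_injective (z := fun i => (g.strand i t₀).2)
      fun i j hij => g.disjoint t₀ (Prod.ext (heq i j) hij)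
    exact ⟨π, Braid.eq_of_homotopic (h π hπ)⟩
  · rintro ⟨π, rfl⟩
    exact ⟨Braid.starGeometric π, Braid.starGeometric_isStarDiagram hn π,
      Braid.eq_of_homotopic (Braid.starGeometric_homotopic hn π)⟩
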